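/- Consider the GI/M/c queue with $c\ge 1$ servers and infinite buffer. The inter-arrival times are i.i.d. nonnegative random variables with distribution $A$ and mean $1/\lambda$, $0<\lambda<\infty$; the service times are i.i.d. exponential with rate $\mu>0$ and independent of the arrivals; and the queue is stable, i.e. $\rho=\lambda/(c\mu)<1$. Let $X_n$ be the number of customers found in the system by the $n$-th arrival. Then $(X_n)$ is a Markov chain on $\{0,1,2,\dots\}$ with transition probabilities $p(i,j)=\int_{[0,\infty)} q_t(i+1,j)\,dA(t)$, where $q_t$ is the transition function of the pure death process whose death rate in state $k$ is $\min(k,c)\mu$. Let $A^*(s)=\int_{[0,\infty)} e^{-st}\,dA(t)$. (a) There is exactly one real $\sigma$ with $|\sigma|<1$ and $\sigma=A^*(c\mu(1-\sigma))$, and it satisfies $0<\sigma<1$. (b) The chain has exactly one stationary probability distribution $\pi$, and $$\pi(n)=C\sigma^n\quad (n\ge c),\qquad C=\frac{1-\sum_{j=0}^{c-1}\pi(j)}{\sigma^c(1-\sigma)^{-1}}.$$ (c) Let $\varepsilon>0$. For every integer $n\ge c$ with $$n>c+\frac{\ln\varepsilon-2\ln(1-\sigma)}{\ln\sigma}$$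 one has $|\pi(n+1)-\pi(n)|<\varepsilon$. (d) Let $\varepsilon>0$. The truncation level $$N=\min\Bigl\{n\in\mathbb N : n\ge c,\ n\ge c+\frac{\ln\varepsilon-2\ln(1-\sigma)}{\ln\sigma}\Bigr\}$$ exists, and $|\pi(n+1)-\pi(n)|<\varepsilon$ for every $n\ge N$. -/

import Mathlib

open MeasureTheory

noncomputable section

namespace GIMc

/-- Total service rate `min(k, c) μ` when `k` customers are present and there are `c` servers,
each working at exponential rate `μ`. -/
def serviceRate (c : ℕ) (μ : ℝ) (k : ℕ) : ℝ := (min k c : ℕ) * μ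

/-- `remaining c μ k j t` is the probability that, of `k` customers present at time `0`, exactly
`j` are still present at time `t` when nobody arrives in between, i.e. the transition function of
the pure death process with rates `serviceRate c μ`, by conditioning on the first departure:
the state `k + 1` is held for an exponential time of rate `serviceRate c μ (k + 1)`, and then the
process restarts afresh from `k`; the state `0` is absorbing. -/
def remaining (c : ℕ) (μ : ℝ) : ℕ → ℕ → ℝ → ℝ
  | 0, j, _ => if j = 0 then 1 else 0
  | k + 1, j, t =>
      (if j = k + 1 then Real.exp (-(serviceRate c μ (k + 1) * t)) else 0) +
        ∫ s in (0 : ℝ)..t,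
          serviceRate c μ (k + 1) * Real.exp (-(serviceRate c μ (k + 1) * s)) *
            remaining c μ k j (t - s)

/-- One-step transition probability `p(i, j)` of the Markov chain of the numbers of customers
found by successive arrivals, for inter-arrival law `A`: an arrival that finds `i` customers
leaves `i + 1` in the system, of whom `j` remain at the end of the inter-arrival time. -/
def transProb (c : ℕ) (μ : ℝ) (A : Measure ℝ) (i j : ℕ) : ℝ :=
  ∫ t in Set.Ici (0 : ℝ), remaining c μ (i + 1) j t ∂A

/-- Laplace-Stieltjes transform of the inter-arrival law. -/
def lst (A : Measure ℝ) (s : ℝ) : ℝ :=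
  ∫ t in Set.Ici (0 : ℝ), Real.exp (-(s * t)) ∂A

/-- `π` is a stationary probability distribution of the chain imbedded at arrival epochs. -/
structure IsArrivalDistribution (c : ℕ) (μ : ℝ) (A : Measure ℝ) (π : ℕ → ℝ) : Prop where
  nonneg : ∀ n, 0 ≤ π n
  hasSum_one : HasSum π 1
  balance : ∀ j, HasSum (fun i => π i * transProb c μ A i j) (π j)

end GIMc

end

/-! While all `c` servers are busy, departures are Poisson of rate `c * μ`, so the number served per
inter-arrival time has generating function `lst A (c * μ * (1 - σ))`; a fixed point `σ` makes a
geometric tail satisfy the balance equations above level `c`. Stability puts the slope of the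
transform at 0 beyond `1 / (c * μ)`, which gives `σ` by the intermediate value theorem; strict
convexity makes it unique.

For existence of `π`, mixtures of the point masses at `0, …, c - 1` and one geometric tail reduce
the problem to a stochastic matrix of size `c + 1` (`exists_isArrivalDistribution`). Uniqueness
holds because every state reaches 0 in one step (`eq_zero_of_invariant`), so every stationary law
has this form. Consecutive terms then differ by `w * σ ^ (n - c) * (1 - σ) ^ 2` with tail mass `w <
1`, and taking logarithms gives the threshold. -/

namespace GIMc

/-! ### The pure death process. -/

theorem serviceRate_nonneg (c : ℕ) {μ : ℝ} (hμ : 0 ≤ μ) (k : ℕ) : 0 ≤ serviceRate c μ k :=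
  mul_nonneg (Nat.cast_nonneg _) hμ

theorem serviceRate_of_le {c k : ℕ} (μ : ℝ) (h : c ≤ k) : serviceRate c μ k = c * μ := by
  simp [serviceRate, min_eq_right h]

theorem serviceRate_pos {c : ℕ} (hc : 1 ≤ c) {μ : ℝ} (hμ : 0 < μ) (k : ℕ) :
    0 < serviceRate c μ (k + 1) := by
  have : 0 < min (k + 1) c := by omega
  exact mul_pos (by exact_mod_cast this) hμ

/-- Substituting `u = t - s` removes `t` from the integrand, leaving a primitive of a fixed
function. -/
theorem remaining_succ (c : ℕ) (μ : ℝ) (k j : ℕ) (t : ℝ) :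
    remaining c μ (k + 1) j t =
      (if j = k + 1 then Real.exp (-(serviceRate c μ (k + 1) * t)) else 0) +
        serviceRate c μ (k + 1) * Real.exp (-(serviceRate c μ (k + 1) * t)) *
          ∫ u in (0 : ℝ)..t, Real.exp (serviceRate c μ (k + 1) * u) * remaining c μ k j u := by
  rw [remaining]
  congr 1
  set r := serviceRate c μ (k + 1)
  have h := intervalIntegral.integral_comp_sub_left (a := 0) (b := t)
    (fun u => r * Real.exp (-(r * (t - u))) * remaining c μ k j u) t
  simp only [sub_sub_cancel, sub_self, sub_zero] at h
  rw [h, ← intervalIntegral.integral_const_mul]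
  congr 1
  ext u
  rw [show -(r * (t - u)) = -(r * t) + r * u by ring, Real.exp_add]
  ring

theorem continuous_remaining (c : ℕ) (μ : ℝ) (k j : ℕ) : Continuous (remaining c μ k j) := by
  induction k with
  | zero => exact continuous_const
  | succ k ih =>
    rw [show remaining c μ (k + 1) j = _ from funext (remaining_succ c μ k j)]
    have h : Continuous fun t : ℝ => ∫ u in (0 : ℝ)..t,
        Real.exp (serviceRate c μ (k + 1) * u) * remaining c μ k j u :=
      intervalIntegral.continuous_primitive
        (fun a b => Continuous.intervalIntegrable (by fun_prop) a b) 0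
    refine Continuous.add ?_ (by fun_prop)
    split_ifs <;> fun_prop

theorem continuous_exp_mul_remaining (c : ℕ) (μ r : ℝ) (k j : ℕ) :
    Continuous fun u : ℝ => Real.exp (r * u) * remaining c μ k j u :=
  (by fun_prop : Continuous fun u : ℝ => Real.exp (r * u)).mul (continuous_remaining c μ k j)

theorem remaining_nonneg (c : ℕ) {μ : ℝ} (hμ : 0 ≤ μ) (k j : ℕ) {t : ℝ} (ht : 0 ≤ t) :
    0 ≤ remaining c μ k j t := by
  induction k generalizing t with
  | zero => rw [remaining]; split_ifs <;> norm_num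
  | succ k ih =>
    rw [remaining_succ]
    refine add_nonneg (by split_ifs <;> positivity)
      (mul_nonneg (mul_nonneg (serviceRate_nonneg c hμ _) (Real.exp_pos _).le) ?_)
    exact intervalIntegral.integral_nonneg ht
      fun u hu => mul_nonneg (Real.exp_pos _).le (ih hu.1)

theorem remaining_eq_zero_of_lt (c : ℕ) (μ : ℝ) {k j : ℕ} (h : k < j) (t : ℝ) :
    remaining c μ k j t = 0 := by
  induction k generalizing t with
  | zero => rw [remaining, if_neg (by omega)]
  | succ k ih =>
    rw [remaining_succ, if_neg (by omega)]
    simp [ih (by omega)]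

theorem mul_integral_exp_mul (r t : ℝ) :
    r * ∫ u in (0 : ℝ)..t, Real.exp (r * u) = Real.exp (r * t) - 1 := by
  rw [← intervalIntegral.integral_const_mul]
  have h : ∀ u ∈ Set.uIcc 0 t,
      HasDerivAt (fun u => Real.exp (r * u)) (r * Real.exp (r * u)) u := fun u _ => by
    simpa [mul_comm] using ((hasDerivAt_id u).const_mul r).exp
  rw [intervalIntegral.integral_eq_sub_of_hasDerivAt h
    (Continuous.intervalIntegrable (by fun_prop) _ _)]
  simp

theorem sum_remaining (c : ℕ) (μ : ℝ) (k : ℕ) (t : ℝ) :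
    ∑ j ∈ Finset.range (k + 1), remaining c μ k j t = 1 := by
  induction k generalizing t with
  | zero => simp [remaining]
  | succ k ih =>
    simp_rw [remaining_succ]
    rw [Finset.sum_add_distrib, ← Finset.mul_sum, Finset.sum_ite_eq',
      if_pos (by simp), ← intervalIntegral.integral_finsetSum
        (fun j _ => (continuous_exp_mul_remaining c μ _ k j).intervalIntegrable _ _)]
    have h : ∀ u : ℝ, ∑ j ∈ Finset.range (k + 1 + 1),
        Real.exp (serviceRate c μ (k + 1) * u) * remaining c μ k j u =
          Real.exp (serviceRate c μ (k + 1) * u) := fun u => by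
      rw [← Finset.mul_sum, Finset.sum_range_succ, ih,
        remaining_eq_zero_of_lt c μ (Nat.lt_succ_self k)]
      ring
    simp_rw [h]
    rw [mul_right_comm, mul_integral_exp_mul, sub_mul, ← Real.exp_add]
    simp

theorem remaining_le_one (c : ℕ) {μ : ℝ} (hμ : 0 ≤ μ) (k j : ℕ) {t : ℝ} (ht : 0 ≤ t) :
    remaining c μ k j t ≤ 1 := by
  rcases lt_or_ge k j with h | h
  · rw [remaining_eq_zero_of_lt c μ h]; exact zero_le_one
  · rw [← sum_remaining c μ k t]
    exact Finset.single_le_sum (f := fun j => remaining c μ k j t)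
      (fun i _ => remaining_nonneg c hμ k i ht) (Finset.mem_range.2 (by omega))

/-- While all servers are busy, departures form a Poisson process of rate `c μ`. -/
theorem remaining_add_of_le {c : ℕ} (hc : 1 ≤ c) (μ : ℝ) {j : ℕ} (hj : c ≤ j) (m : ℕ) (t : ℝ) :
    remaining c μ (j + m) j t =
      Real.exp (-(c * μ * t)) * ((c * μ * t) ^ m / (m.factorial : ℝ)) := by
  induction m generalizing t with
  | zero =>
    obtain ⟨k, rfl⟩ : ∃ k, j = k + 1 := ⟨j - 1, by omega⟩
    simp [remaining_succ, remaining_eq_zero_of_lt, serviceRate_of_le μ hj]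
  | succ m ih =>
    rw [← add_assoc, remaining_succ, if_neg (by omega), zero_add,
      serviceRate_of_le μ (by omega : c ≤ j + m + 1)]
    have h : ∀ u : ℝ, Real.exp (c * μ * u) * remaining c μ (j + m) j u =
        (c * μ) ^ m / (m.factorial : ℝ) * u ^ m := fun u => by
      rw [ih, ← mul_assoc, ← Real.exp_add]
      simp only [add_neg_cancel, Real.exp_zero]
      ring
    simp_rw [h]
    rw [intervalIntegral.integral_const_mul, integral_pow, Nat.factorial_succ]
    push_cast
    have : (m.factorial : ℝ) ≠ 0 := by positivity
    have : (m : ℝ) + 1 ≠ 0 := by positivity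
    field_simp
    ring

theorem remaining_zero_pos {c : ℕ} (hc : 1 ≤ c) {μ : ℝ} (hμ : 0 < μ) (k : ℕ) {t : ℝ}
    (ht : 0 < t) : 0 < remaining c μ k 0 t := by
  induction k generalizing t with
  | zero => simp [remaining]
  | succ k ih =>
    rw [remaining_succ, if_neg (by omega), zero_add]
    refine mul_pos (mul_pos (serviceRate_pos hc hμ k) (Real.exp_pos _)) ?_
    refine intervalIntegral.intervalIntegral_pos_of_pos_on
      ((continuous_exp_mul_remaining c μ _ k 0).intervalIntegrable _ _) ?_ ht
    exact fun u hu => mul_pos (Real.exp_pos _) (ih hu.1)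

end GIMc

/-! ### Transition probabilities of the imbedded chain. -/

namespace GIMc

variable {A : Measure ℝ}

theorem ae_nonneg_of_measure_Iio (hA : A (Set.Iio 0) = 0) : ∀ᵐ t ∂A, 0 ≤ t := by
  rw [ae_iff]
  simp only [not_le]
  exact hA

theorem restrict_Ici_eq_self (hA : A (Set.Iio 0) = 0) : A.restrict (Set.Ici 0) = A :=
  Measure.restrict_eq_self_of_ae_mem (ae_nonneg_of_measure_Iio hA)

theorem lst_eq_integral (hA : A (Set.Iio 0) = 0) (s : ℝ) :
    lst A s = ∫ t, Real.exp (-(s * t)) ∂A := by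
  rw [lst, restrict_Ici_eq_self hA]

theorem transProb_eq_integral (hA : A (Set.Iio 0) = 0) (c : ℕ) (μ : ℝ) (i j : ℕ) :
    transProb c μ A i j = ∫ t, remaining c μ (i + 1) j t ∂A := by
  rw [transProb, restrict_Ici_eq_self hA]

theorem transProb_nonneg (hA : A (Set.Iio 0) = 0) (c : ℕ) {μ : ℝ} (hμ : 0 ≤ μ) (i j : ℕ) :
    0 ≤ transProb c μ A i j := by
  rw [transProb_eq_integral hA]
  exact integral_nonneg_of_ae ((ae_nonneg_of_measure_Iio hA).mono
    fun t ht => remaining_nonneg c hμ _ j ht)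

theorem transProb_eq_zero (c : ℕ) (μ : ℝ) {i j : ℕ} (h : i + 1 < j) :
    transProb c μ A i j = 0 := by
  simp [transProb, remaining_eq_zero_of_lt c μ h]

variable [IsProbabilityMeasure A]

theorem integrable_remaining (hA : A (Set.Iio 0) = 0) (c : ℕ) {μ : ℝ} (hμ : 0 ≤ μ) (k j : ℕ) :
    Integrable (remaining c μ k j) A := by
  refine Integrable.of_bound (continuous_remaining c μ k j).aestronglyMeasurable 1
    ((ae_nonneg_of_measure_Iio hA).mono fun t ht => ?_)
  rw [Real.norm_of_nonneg (remaining_nonneg c hμ k j ht)]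
  exact remaining_le_one c hμ k j ht

theorem hasSum_transProb (hA : A (Set.Iio 0) = 0) (c : ℕ) {μ : ℝ} (hμ : 0 ≤ μ) (i : ℕ) :
    HasSum (transProb c μ A i) 1 := by
  have h : ∑ j ∈ Finset.range (i + 1 + 1), transProb c μ A i j = 1 := by
    simp_rw [transProb_eq_integral hA]
    rw [← integral_finsetSum _ fun j _ => integrable_remaining hA c hμ (i + 1) j]
    simp [sum_remaining]
  rw [← h]
  exact hasSum_sum_of_ne_finset_zero fun j hj =>
    transProb_eq_zero c μ (by simpa using hj)

/-- A positive mean keeps `A` from being concentrated at 0, and in any positive time the system may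
empty. -/
theorem transProb_zero_pos (hA : A (Set.Iio 0) = 0) (hpos : 0 < ∫ t, t ∂A) {c : ℕ} (hc : 1 ≤ c)
    {μ : ℝ} (hμ : 0 < μ) (i : ℕ) : 0 < transProb c μ A i 0 := by
  refine (transProb_nonneg hA c hμ.le i 0).lt_of_ne' fun h => ?_
  rw [transProb_eq_integral hA, integral_eq_zero_iff_of_nonneg_ae
    ((ae_nonneg_of_measure_Iio hA).mono fun t ht => remaining_nonneg c hμ.le _ 0 ht)
    (integrable_remaining hA c hμ.le _ _)] at h
  refine hpos.ne' (integral_eq_zero_of_ae ?_)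
  filter_upwards [h, ae_nonneg_of_measure_Iio hA] with t h0 ht
  by_contra hne
  exact (remaining_zero_pos hc hμ (i + 1) (ht.lt_of_ne' hne)).ne' h0

/-- The generating function of the number of departures in an inter-arrival time during which
all servers are busy. -/
theorem hasSum_pow_mul_transProb (hA : A (Set.Iio 0) = 0) {c : ℕ} (hc : 1 ≤ c) {μ : ℝ}
    (hμ : 0 ≤ μ) {j : ℕ} (hj : c ≤ j + 1) {σ : ℝ} (h0 : 0 ≤ σ) (h1 : σ < 1) :
    HasSum (fun k => σ ^ k * transProb c μ A (j + k) (j + 1)) (lst A (c * μ * (1 - σ))) := by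
  have hform : ∀ k t, remaining c μ (j + k + 1) (j + 1) t =
      Real.exp (-(c * μ * t)) * ((c * μ * t) ^ k / (k.factorial : ℝ)) := fun k t => by
    rw [add_right_comm, remaining_add_of_le hc μ hj]
  have hint : ∀ k, Integrable (fun t => σ ^ k * remaining c μ (j + k + 1) (j + 1) t) A :=
    fun k => (integrable_remaining hA c hμ _ _).const_mul _
  -- Domination by `σ ^ k` justifies exchanging sum and integral.
  have hsum : Summable fun k => ∫ t, ‖σ ^ k * remaining c μ (j + k + 1) (j + 1) t‖ ∂A := by
    refine Summable.of_nonneg_of_le (fun k => integral_nonneg fun t => norm_nonneg _) (fun k => ?_)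
      (summable_geometric_of_lt_one h0 h1)
    have := integral_mono_ae (hint k).norm (integrable_const (σ ^ k))
      ((ae_nonneg_of_measure_Iio hA).mono fun t ht => by
        simp only [norm_mul, norm_pow, Real.norm_of_nonneg h0,
          Real.norm_of_nonneg (remaining_nonneg c hμ _ (j + 1) ht)]
        exact mul_le_of_le_one_right (by positivity) (remaining_le_one c hμ _ _ ht))
    simpa using this
  have h := hasSum_integral_of_summable_integral_norm hint hsum
  simp_rw [integral_const_mul, ← transProb_eq_integral hA] at h
  suffices heq : ∀ t, ∑' k, σ ^ k * remaining c μ (j + k + 1) (j + 1) t =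
      Real.exp (-(c * μ * (1 - σ) * t)) by
    simp_rw [heq, ← lst_eq_integral hA] at h
    exact h
  intro t
  have he : HasSum (fun k => Real.exp (-(c * μ * t)) * ((c * μ * t * σ) ^ k / (k.factorial : ℝ)))
      (Real.exp (-(c * μ * t)) * Real.exp (c * μ * t * σ)) := by
    refine HasSum.mul_left _ ?_
    rw [Real.exp_eq_exp_ℝ]
    exact NormedSpace.expSeries_div_hasSum_exp _
  rw [← Real.exp_add, show -(c * μ * t) + c * μ * t * σ = -(c * μ * (1 - σ) * t) by ring] at he
  rw [← he.tsum_eq]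
  refine tsum_congr fun k => ?_
  rw [hform, mul_pow]
  ring

end GIMc

/-! ### Invariant vectors of stochastic matrices. -/

namespace GIMc

variable {ι : Type*} {p : ι → ι → ℝ}

theorem summable_mul_stochastic (hp : ∀ i j, 0 ≤ p i j) (hsum : ∀ i, HasSum (p i) 1)
    {x : ι → ℝ} (hx : Summable x) : Summable fun q : ι × ι => x q.1 * p q.1 q.2 := by
  refine Summable.of_norm ?_
  rw [summable_prod_of_nonneg fun q => norm_nonneg _]
  have h : ∀ i, HasSum (fun j => ‖x i * p i j‖) |x i| := fun i => by
    simpa [abs_mul, abs_of_nonneg (hp i _)] using (hsum i).mul_left |x i|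
  exact ⟨fun i => (h i).summable, by simpa only [(h _).tsum_eq] using hx.abs⟩

/-- A stochastic matrix preserves total mass. -/
theorem hasSum_tsum_mul_stochastic (hp : ∀ i j, 0 ≤ p i j) (hsum : ∀ i, HasSum (p i) 1)
    {x : ι → ℝ} (hx : Summable x) :
    HasSum (fun j => ∑' i, x i * p i j) (∑' i, x i) := by
  have hs := summable_mul_stochastic hp hsum hx
  have h1 : ∑' q : ι × ι, x q.1 * p q.1 q.2 = ∑' i, x i := by
    rw [hs.tsum_prod]
    exact tsum_congr fun i => by simpa using ((hsum i).mul_left (x i)).tsum_eq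
  have h2 := (Equiv.prodComm ι ι).hasSum_iff.2 hs.hasSum
  rw [h1] at h2
  exact h2.prod_fiberwise fun j =>
    (hs.prod_symm.prod_factor j).hasSum

theorem summable_mul_stochastic_col (hp : ∀ i j, 0 ≤ p i j) (hsum : ∀ i, HasSum (p i) 1)
    {x : ι → ℝ} (hx : Summable x) (j : ι) : Summable fun i => x i * p i j :=
  (summable_mul_stochastic hp hsum hx).prod_symm.prod_factor j

/-- The absolute value of an invariant vector of a stochastic matrix is invariant. -/
theorem hasSum_abs_mul_stochastic (hp : ∀ i j, 0 ≤ p i j) (hsum : ∀ i, HasSum (p i) 1)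
    {x : ι → ℝ} (hx : Summable x) (hbal : ∀ j, HasSum (fun i => x i * p i j) (x j)) (j : ι) :
    HasSum (fun i => |x i| * p i j) |x j| := by
  have hcol := summable_mul_stochastic_col hp hsum hx.abs
  -- The triangle inequality makes each defect nonnegative; conservation of mass makes their sum
  -- zero.
  have hle : ∀ j, 0 ≤ (∑' i, |x i| * p i j) - |x j| := fun j => by
    rw [sub_nonneg, ← (hbal j).tsum_eq]
    have := norm_tsum_le_tsum_norm (f := fun i => x i * p i j)
      (by simpa [abs_mul, abs_of_nonneg (hp _ j)] using hcol j)
    simpa [abs_mul, abs_of_nonneg (hp _ j)] using this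
  have h := (hasSum_tsum_mul_stochastic hp hsum hx.abs).sub hx.abs.hasSum
  rw [sub_self, hasSum_zero_iff_of_nonneg hle] at h
  have hj := congrFun h j
  simp only [Pi.zero_apply] at hj
  rw [← sub_eq_zero.1 hj]
  exact (hcol j).hasSum

/-- An invariant summable vector of zero total mass vanishes when some state can be reached in
one step from every state. -/
theorem eq_zero_of_invariant (hp : ∀ i j, 0 ≤ p i j) (hsum : ∀ i, HasSum (p i) 1) {o : ι}
    (ho : ∀ i, 0 < p i o) {x : ι → ℝ} (hx : HasSum x 0)
    (hbal : ∀ j, HasSum (fun i => x i * p i j) (x j)) : x = 0 := by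
  -- Subtracting the balance equations of `|y|` and `y` at `o` leaves a zero sum of terms `(|y i| -
  -- y i) * p i o ≥ 0`, so `y` has no negative entry.
  have key : ∀ y : ι → ℝ, HasSum y 0 → (∀ j, HasSum (fun i => y i * p i j) (y j)) →
      0 ≤ y o → y = 0 := fun y hy hyb hyo => by
    have h := (hasSum_abs_mul_stochastic hp hsum hy.summable hyb o).sub (hyb o)
    rw [abs_of_nonneg hyo, sub_self, hasSum_zero_iff_of_nonneg fun i => by
      simpa [← sub_mul] using mul_nonneg (sub_nonneg.2 (le_abs_self (y i))) (hp i o)] at h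
    have hnn : ∀ i, 0 ≤ y i := fun i => by
      have hi := congrFun h i
      simp only [Pi.zero_apply, ← sub_mul, mul_eq_zero, (ho i).ne', or_false, sub_eq_zero] at hi
      exact hi ▸ abs_nonneg _
    exact (hasSum_zero_iff_of_nonneg hnn).1 hy
  rcases le_total 0 (x o) with h | h
  · exact key x hx hbal h
  · refine neg_eq_zero.1 (key (-x) (neg_zero (G := ℝ) ▸ hx.neg) (fun j => ?_) (by simpa using h))
    simpa using (hbal j).neg

/-- A finite stochastic matrix has a stationary distribution. -/
theorem exists_stationary_of_fintype [Fintype ι] [Nonempty ι] (hp : ∀ i j, 0 ≤ p i j)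
    (hsum : ∀ i, ∑ j, p i j = 1) :
    ∃ x : ι → ℝ, (∀ i, 0 ≤ x i) ∧ ∑ i, x i = 1 ∧ ∀ j, ∑ i, x i * p i j = x j := by
  classical
  -- Row sums 1 make `M` kill the constant vector, so it also has a left null vector, whose absolute
  -- value is normalized below.
  let M : Matrix ι ι ℝ := Matrix.of p - 1
  have hdet : M.det = 0 := by
    refine Matrix.exists_mulVec_eq_zero_iff.1 ⟨fun _ => 1, ?_, ?_⟩
    · intro h
      exact one_ne_zero (congrFun h (Classical.arbitrary ι))
    · ext i
      simp [M, Matrix.mulVec, dotProduct, hsum, Matrix.one_apply]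
  obtain ⟨v, hv0, hv⟩ := Matrix.exists_vecMul_eq_zero_iff.2 hdet
  have hbal : ∀ j, ∑ i, v i * p i j = v j := fun j => by
    have := congrFun hv j
    simp only [M, Matrix.vecMul_sub, Matrix.vecMul_one, Pi.sub_apply, Pi.zero_apply,
      sub_eq_zero] at this
    exact this
  have habs : ∀ j, ∑ i, |v i| * p i j = |v j| := fun j =>
    (hasSum_fintype _).unique (hasSum_abs_mul_stochastic hp
      (fun i => hsum i ▸ hasSum_fintype _) (hasSum_fintype v).summable
      (fun j => hbal j ▸ hasSum_fintype _) j)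
  obtain ⟨a, ha⟩ := Function.ne_iff.1 hv0
  have hpos : 0 < ∑ i, |v i| :=
    Finset.sum_pos' (fun i _ => abs_nonneg _) ⟨a, Finset.mem_univ _, abs_pos.2 ha⟩
  refine ⟨fun i => |v i| / ∑ i, |v i|, fun i => by positivity, ?_, fun j => ?_⟩
  · rw [← Finset.sum_div, div_self hpos.ne']
  · simp_rw [div_mul_eq_mul_div]
    rw [← Finset.sum_div, habs]

end GIMc

/-! ### Existence of a stationary law with geometric tail. -/

namespace GIMc

/-- The geometric distribution of ratio `σ` on `{c, c + 1, …}`. -/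
def geometricTail (c : ℕ) (σ : ℝ) (n : ℕ) : ℝ := if n < c then 0 else (1 - σ) * σ ^ (n - c)

theorem geometricTail_nonneg (c : ℕ) {σ : ℝ} (h0 : 0 ≤ σ) (h1 : σ < 1) (n : ℕ) :
    0 ≤ geometricTail c σ n := by
  rw [geometricTail]
  split_ifs
  · rfl
  · exact mul_nonneg (sub_nonneg.2 h1.le) (pow_nonneg h0 _)

theorem geometricTail_add (c : ℕ) (σ : ℝ) {n : ℕ} (hn : c ≤ n) (k : ℕ) :
    geometricTail c σ (n + k) = geometricTail c σ n * σ ^ k := by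
  rw [geometricTail, geometricTail, if_neg (by omega), if_neg (by omega), Nat.sub_add_comm hn,
    pow_add, mul_assoc]

theorem hasSum_geometricTail (c : ℕ) {σ : ℝ} (h0 : 0 ≤ σ) (h1 : σ < 1) :
    HasSum (geometricTail c σ) 1 := by
  rw [← hasSum_nat_add_iff' c, Finset.sum_eq_zero fun i hi => by
    rw [geometricTail, if_pos (Finset.mem_range.1 hi)], sub_zero]
  have h := (hasSum_geometric_of_lt_one h0 h1).mul_left (1 - σ)
  rw [mul_inv_cancel₀ (by linarith)] at h
  refine h.congr_fun ?_
  intro n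
  simp [geometricTail]

/-- The geometric tail is reproduced by the chain above level `c`. -/
theorem hasSum_geometricTail_mul_transProb {A : Measure ℝ} [IsProbabilityMeasure A]
    (hA : A (Set.Iio 0) = 0) {c : ℕ} (hc : 1 ≤ c) {μ : ℝ} (hμ : 0 ≤ μ) {σ : ℝ} (h0 : 0 ≤ σ)
    (h1 : σ < 1) (hσ : σ = lst A (c * μ * (1 - σ))) {j : ℕ} (hj : c ≤ j) :
    HasSum (fun i => geometricTail c σ i * transProb c μ A i (j + 1))
      (geometricTail c σ (j + 1)) := by
  -- The chain climbs at most one level per step, so only `i ≥ j ≥ c` contribute, where the tail is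
  -- purely geometric.
  rw [← hasSum_nat_add_iff' j, Finset.sum_eq_zero fun i hi => by
    rw [transProb_eq_zero c μ (by simpa using hi), mul_zero], sub_zero,
    geometricTail_add c σ hj, pow_one]
  have h := (hasSum_pow_mul_transProb hA hc hμ (by omega : c ≤ j + 1) h0 h1).mul_left
    (geometricTail c σ j)
  rw [← hσ] at h
  refine h.congr_fun fun k => ?_
  rw [add_comm k j, geometricTail_add c σ hj, mul_assoc]

theorem exists_isArrivalDistribution {A : Measure ℝ} [IsProbabilityMeasure A]
    (hA : A (Set.Iio 0) = 0) {c : ℕ} (hc : 1 ≤ c) {μ : ℝ} (hμ : 0 ≤ μ) {σ : ℝ} (h0 : 0 ≤ σ)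
    (h1 : σ < 1) (hσ : σ = lst A (c * μ * (1 - σ))) :
    ∃ π : ℕ → ℝ, IsArrivalDistribution c μ A π ∧
      ∃ w : ℝ, ∀ n, c ≤ n → π n = w * geometricTail c σ n := by
  have hp := transProb_nonneg hA c hμ
  have hp1 := hasSum_transProb hA c hμ
  -- Index `c` stands for the whole geometric tail, the others for point masses.
  let e : Fin (c + 1) → ℕ → ℝ := fun i n =>
    if (i : ℕ) < c then (if n = i then 1 else 0) else geometricTail c σ n
  have he0 : ∀ i n, 0 ≤ e i n := fun i n => by
    simp only [e]
    split_ifs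
    exacts [zero_le_one, le_rfl, geometricTail_nonneg c h0 h1 n]
  have he1 : ∀ i, HasSum (e i) 1 := fun i => by
    by_cases hi : (i : ℕ) < c
    · simpa only [e, if_pos hi] using hasSum_ite_eq (i : ℕ) (1 : ℝ)
    · simpa only [e, if_neg hi] using hasSum_geometricTail c h0 h1
  let m : Fin (c + 1) → ℕ → ℝ := fun i l => ∑' n, e i n * transProb c μ A n l
  have hm : ∀ i l, HasSum (fun n => e i n * transProb c μ A n l) (m i l) := fun i l =>
    (summable_mul_stochastic_col hp hp1 (he1 i).summable l).hasSum
  have hm0 : ∀ i l, 0 ≤ m i l := fun i l => tsum_nonneg fun n => mul_nonneg (he0 i n) (hp n l)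
  have hm1 : ∀ i, HasSum (m i) 1 := fun i =>
    (he1 i).tsum_eq ▸ hasSum_tsum_mul_stochastic hp hp1 (he1 i).summable
  -- The last column lumps all mass sent to levels `≥ c`.
  let M : Fin (c + 1) → Fin (c + 1) → ℝ := fun i j =>
    if (j : ℕ) < c then m i j else 1 - ∑ l ∈ Finset.range c, m i l
  obtain ⟨ν, hν0, hν1, hν⟩ := exists_stationary_of_fintype (p := M)
    (fun i j => by
      simp only [M]
      split_ifs
      · exact hm0 i j
      · exact sub_nonneg.2 (sum_le_hasSum _ (fun l _ => hm0 i l) (hm1 i)))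
    (fun i => by
      rw [Fin.sum_univ_castSucc]
      simp [M, Fin.sum_univ_eq_sum_range (fun l => m i l) c])
  let π : ℕ → ℝ := fun n => ∑ i, ν i * e i n
  have hπtail : ∀ n, c ≤ n → π n = ν (Fin.last c) * geometricTail c σ n := fun n hn => by
    simp only [π]
    rw [Fin.sum_univ_castSucc, Finset.sum_eq_zero fun i _ => by
      simp [e, (lt_of_lt_of_le i.2 hn).ne']]
    simp [e]
  have hπhead : ∀ j : Fin c, π j = ν j.castSucc := fun j => by
    simp only [π]
    rw [Fin.sum_univ_castSucc, Finset.sum_eq_single j (fun i _ hij => by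
      simp [e, Fin.val_inj, hij.symm]) (by simp)]
    simp [e, geometricTail]
  have hπ1 : HasSum π 1 := by
    have := hasSum_sum (s := Finset.univ) fun i _ => (he1 i).mul_left (ν i)
    simpa only [mul_one, hν1] using this
  have hS : ∀ j, HasSum (fun n => π n * transProb c μ A n j) (∑ i, ν i * m i j) := fun j => by
    have := hasSum_sum (s := Finset.univ) fun i _ => (hm i j).mul_left (ν i)
    simpa only [π, Finset.sum_mul, mul_assoc] using this
  have hlt : ∀ j, j < c → ∑ i, ν i * m i j = π j := fun j hj => by
    have := hν (Fin.castSucc ⟨j, hj⟩)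
    rw [← hπhead] at this
    simpa [M, hj] using this
  have hgt : ∀ j, c < j → ∑ i, ν i * m i j = π j := fun j hj => by
    obtain ⟨j, rfl⟩ : ∃ k, j = k + 1 := ⟨j - 1, by omega⟩
    refine (hS (j + 1)).unique ?_
    rw [hπtail _ hj.le]
    refine ((hasSum_geometricTail_mul_transProb hA hc hμ h0 h1 hσ
      (by omega : c ≤ j)).mul_left (ν (Fin.last c))).congr_fun fun i => ?_
    rcases lt_or_ge i c with hi | hi
    · simp [transProb_eq_zero c μ (by omega : i + 1 < j + 1)]
    · rw [hπtail i hi, mul_assoc]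
  -- Balance at level `c` is the one equation left; it follows from the others by conservation of
  -- total mass.
  have heq : ∑ i, ν i * m i c = π c := by
    have h := hasSum_tsum_mul_stochastic hp hp1 hπ1.summable
    simp_rw [(hS _).tsum_eq, hπ1.tsum_eq] at h
    have hd := h.sub hπ1
    rw [sub_self] at hd
    have hs := hasSum_single (f := fun j => ∑ i, ν i * m i j - π j) c fun j hj => by
      rcases lt_or_gt_of_ne hj with hj | hj
      exacts [sub_eq_zero.2 (hlt j hj), sub_eq_zero.2 (hgt j hj)]
    exact sub_eq_zero.1 (hs.unique hd)
  refine ⟨π, ⟨fun n => Finset.sum_nonneg fun i _ => mul_nonneg (hν0 i) (he0 i n), hπ1,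
    fun j => ?_⟩, ν (Fin.last c), hπtail⟩
  rcases lt_trichotomy j c with hj | rfl | hj
  exacts [hlt j hj ▸ hS j, heq ▸ hS j, hgt j hj ▸ hS j]

end GIMc

/-! ### The fixed point of the Laplace-Stieltjes transform. -/

namespace GIMc

open Filter Topology

variable {A : Measure ℝ} [IsProbabilityMeasure A]

theorem norm_exp_neg_mul_le_one {s t : ℝ} (hs : 0 ≤ s) (ht : 0 ≤ t) :
    ‖Real.exp (-(s * t))‖ ≤ 1 := by
  rw [Real.norm_of_nonneg (Real.exp_pos _).le, Real.exp_le_one_iff]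
  exact neg_nonpos.2 (mul_nonneg hs ht)

theorem integrable_exp_neg_mul (hA : A (Set.Iio 0) = 0) {s : ℝ} (hs : 0 ≤ s) :
    Integrable (fun t => Real.exp (-(s * t))) A :=
  Integrable.of_bound (by fun_prop : Continuous fun t : ℝ =>
    Real.exp (-(s * t))).aestronglyMeasurable 1
    ((ae_nonneg_of_measure_Iio hA).mono fun _ ht => norm_exp_neg_mul_le_one hs ht)

theorem lst_pos (hA : A (Set.Iio 0) = 0) {s : ℝ} (hs : 0 ≤ s) : 0 < lst A s := by
  rw [lst_eq_integral hA]
  exact integral_exp_pos (integrable_exp_neg_mul hA hs)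

theorem continuousOn_lst (hA : A (Set.Iio 0) = 0) : ContinuousOn (lst A) (Set.Ici 0) := by
  rw [show lst A = _ from funext (lst_eq_integral hA)]
  refine continuousOn_of_dominated (bound := fun _ => 1) (fun s _ =>
    (by fun_prop : Continuous fun t : ℝ => Real.exp (-(s * t))).aestronglyMeasurable)
    (fun s hs => (ae_nonneg_of_measure_Iio hA).mono fun _ ht => norm_exp_neg_mul_le_one hs ht)
    (integrable_const 1) (Eventually.of_forall fun t => by fun_prop)

/-- Strict convexity of `exp`, integrated over a law not concentrated at 0: `(1 - lst A x) / x` is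
strictly decreasing. -/
theorem one_sub_lst_mul_lt (hA : A (Set.Iio 0) = 0) (hpos : 0 < ∫ t, t ∂A) {θ x : ℝ}
    (hθ0 : 0 < θ) (hθ1 : θ < 1) (hx : 0 < x) :
    θ * (1 - lst A x) < 1 - lst A (θ * x) := by
  have hi1 := integrable_exp_neg_mul hA hx.le
  have hi2 := integrable_exp_neg_mul hA (mul_pos hθ0 hx).le
  have hi3 : Integrable (fun t => θ * Real.exp (-(x * t)) + (1 - θ)) A :=
    (hi1.const_mul θ).add (integrable_const _)
  have hint : Integrable (fun t => θ * Real.exp (-(x * t)) + (1 - θ) -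
      Real.exp (-(θ * x * t))) A := hi3.sub hi2
  have hexp : ∀ t : ℝ, t ≠ 0 →
      0 < θ * Real.exp (-(x * t)) + (1 - θ) - Real.exp (-(θ * x * t)) := fun t ht => by
    have := strictConvexOn_exp.2 (Set.mem_univ (-(x * t))) (Set.mem_univ 0)
      (by simpa using ⟨hx.ne', ht⟩) hθ0 (sub_pos.2 hθ1) (by ring)
    simp only [smul_eq_mul, mul_zero, add_zero, Real.exp_zero, mul_one] at this
    rw [show θ * -(x * t) = -(θ * x * t) by ring] at this
    linarith
  have hnn : ∀ t : ℝ, 0 ≤ θ * Real.exp (-(x * t)) + (1 - θ) - Real.exp (-(θ * x * t)) :=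
    fun t => by
      rcases eq_or_ne t 0 with rfl | ht
      · simp
      · exact (hexp t ht).le
  have hlt : 0 < ∫ t, (θ * Real.exp (-(x * t)) + (1 - θ) - Real.exp (-(θ * x * t))) ∂A := by
    refine (integral_nonneg hnn).lt_of_ne' fun h => hpos.ne' ?_
    rw [integral_eq_zero_iff_of_nonneg hnn hint] at h
    refine integral_eq_zero_of_ae (h.mono fun t ht => ?_)
    by_contra hne
    exact (hexp t hne).ne' ht
  rw [integral_sub hi3 hi2,
    integral_add (hi1.const_mul θ) (integrable_const _), integral_const_mul,
    ← lst_eq_integral hA, ← lst_eq_integral hA] at hlt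
  simp only [integral_const, probReal_univ, one_smul] at hlt
  linarith

/-- The right derivative of the Laplace-Stieltjes transform at `0`. -/
theorem tendsto_one_sub_lst_div (hA : A (Set.Iio 0) = 0) (hAint : Integrable (fun t : ℝ => t) A) :
    Tendsto (fun x => (1 - lst A x) / x) (𝓝[>] 0) (𝓝 (∫ t, t ∂A)) := by
  have h : Tendsto (fun x => ∫ t, (1 - Real.exp (-(x * t))) / x ∂A) (𝓝[>] 0)
      (𝓝 (∫ t, t ∂A)) := by
    refine tendsto_integral_filter_of_dominated_convergence (fun t => t)
      (Eventually.of_forall fun x => (by fun_prop : Continuous fun t : ℝ =>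
        (1 - Real.exp (-(x * t))) / x).aestronglyMeasurable) ?_ hAint
      (Eventually.of_forall fun t => ?_)
    · filter_upwards [self_mem_nhdsWithin] with x hx
      filter_upwards [ae_nonneg_of_measure_Iio hA] with t ht
      have hx : 0 < x := hx
      have h1 : Real.exp (-(x * t)) ≤ 1 := by
        rw [Real.exp_le_one_iff]
        exact neg_nonpos.2 (mul_nonneg hx.le ht)
      rw [Real.norm_of_nonneg (div_nonneg (by linarith) hx.le), div_le_iff₀ hx]
      linarith [Real.add_one_le_exp (-(x * t))]
    · have hd : HasDerivAt (fun x : ℝ => -Real.exp (-(x * t))) t 0 := by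
        simpa using ((hasDerivAt_id (0 : ℝ)).mul_const t).fun_neg.exp.fun_neg
      refine ((hasDerivAt_iff_tendsto_slope.1 hd).mono_left
        (nhdsWithin_mono _ fun x hx => (ne_of_gt hx))).congr fun x => ?_
      simp [slope_def_field]
      ring
  refine h.congr' ?_
  filter_upwards [self_mem_nhdsWithin] with x hx
  rw [integral_div, integral_sub (integrable_const _) (integrable_exp_neg_mul hA (le_of_lt hx)),
    ← lst_eq_integral hA]
  simp

theorem exists_lst_fixedPoint (hA : A (Set.Iio 0) = 0) (hAint : Integrable (fun t : ℝ => t) A)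
    {a : ℝ} (ha : 0 < a) (hmean : 1 / a < ∫ t, t ∂A) :
    ∃ σ : ℝ, 0 < σ ∧ σ < 1 ∧ σ = lst A (a * (1 - σ)) := by
  obtain ⟨x, hx1, hx0, hxa⟩ := (((tendsto_one_sub_lst_div hA hAint).eventually_const_lt
    hmean).and (Ioo_mem_nhdsGT ha)).exists
  rw [lt_div_iff₀ hx0, one_div_mul_eq_div] at hx1
  have hxa' : x / a < 1 := (div_lt_one ha).2 hxa
  have hxa0 : 0 < x / a := div_pos hx0 ha
  -- Stopping at `1 - x / a`, where the difference is already negative, excludes the trivial root 1.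
  have hcont : ContinuousOn (fun s => lst A (a * (1 - s)) - s) (Set.Icc 0 (1 - x / a)) := by
    refine ContinuousOn.sub ((continuousOn_lst hA).comp (by fun_prop) fun s hs => ?_)
      continuousOn_id
    exact mul_nonneg ha.le (by linarith [hs.2])
  obtain ⟨σ, hσ, hσ0⟩ := intermediate_value_Icc' (by linarith : 0 ≤ 1 - x / a) hcont
    (show (0 : ℝ) ∈ _ from ⟨by
      rw [show a * (1 - (1 - x / a)) = x by field_simp; ring]
      linarith, by
      simpa using (lst_pos hA ha.le).le⟩)
  have hfix : σ = lst A (a * (1 - σ)) := by linarith [hσ0]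
  refine ⟨σ, ?_, by linarith [hσ.2], hfix⟩
  rw [hfix]
  exact lst_pos hA (mul_nonneg ha.le (by linarith [hσ.2]))

/-- At a fixed point `(1 - lst A x) / x = 1 / a` with `x = a * (1 - s)`, and a strictly decreasing
function takes this value only once. -/
theorem lst_fixedPoint_unique (hA : A (Set.Iio 0) = 0) (hpos : 0 < ∫ t, t ∂A) {a : ℝ}
    (ha : 0 < a) {s σ : ℝ} (hs1 : s < 1) (hs : s = lst A (a * (1 - s))) (hσ1 : σ < 1)
    (hσ : σ = lst A (a * (1 - σ))) : s = σ := by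
  have key : ∀ u v : ℝ, v < 1 → u = lst A (a * (1 - u)) → v = lst A (a * (1 - v)) → ¬ u < v :=
    fun u v hv hu' hv' huv => by
      have hu0 : 0 < 1 - u := by linarith
      have h := one_sub_lst_mul_lt hA hpos (θ := (1 - v) / (1 - u))
        (div_pos (by linarith) hu0) ((div_lt_one hu0).2 (by linarith)) (mul_pos ha hu0)
      rw [← hu', show (1 - v) / (1 - u) * (a * (1 - u)) = a * (1 - v) by field_simp, ← hv',
        div_mul_cancel₀ _ hu0.ne'] at h
      exact lt_irrefl _ h
  exact le_antisymm (not_lt.1 (key σ s hs1 hσ hs)) (not_lt.1 (key s σ hσ1 hs hσ))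

end GIMc

/-! ### Uniqueness of the stationary law and the truncation bound. -/

namespace GIMc

theorem IsArrivalDistribution.unique {A : Measure ℝ} [IsProbabilityMeasure A]
    (hA : A (Set.Iio 0) = 0) (hpos : 0 < ∫ t, t ∂A) {c : ℕ} (hc : 1 ≤ c) {μ : ℝ} (hμ : 0 < μ)
    {π π' : ℕ → ℝ} (h : IsArrivalDistribution c μ A π) (h' : IsArrivalDistribution c μ A π') :
    π' = π := by
  refine sub_eq_zero.1 (eq_zero_of_invariant (transProb_nonneg hA c hμ.le)
    (hasSum_transProb hA c hμ.le) (transProb_zero_pos hA hpos hc hμ)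
    (sub_self (1 : ℝ) ▸ h'.hasSum_one.sub h.hasSum_one) fun j => ?_)
  simpa only [Pi.sub_apply, sub_mul] using (h'.balance j).sub (h.balance j)

theorem IsArrivalDistribution.zero_pos {A : Measure ℝ} [IsProbabilityMeasure A]
    (hA : A (Set.Iio 0) = 0) (hpos : 0 < ∫ t, t ∂A) {c : ℕ} (hc : 1 ≤ c) {μ : ℝ} (hμ : 0 < μ)
    {π : ℕ → ℝ} (h : IsArrivalDistribution c μ A π) : 0 < π 0 := by
  refine (h.nonneg 0).lt_of_ne' fun h0 => ?_
  have hb := h.balance 0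
  rw [h0, hasSum_zero_iff_of_nonneg fun i =>
    mul_nonneg (h.nonneg i) (transProb_nonneg hA c hμ.le i 0)] at hb
  have hz : π = 0 := funext fun i =>
    (mul_eq_zero.1 (congrFun hb i)).resolve_right (transProb_zero_pos hA hpos hc hμ i).ne'
  exact zero_ne_one (hasSum_zero.unique (hz ▸ h.hasSum_one))

theorem pow_mul_one_sub_sq_le_iff {σ ε : ℝ} (h0 : 0 < σ) (h1 : σ < 1) (hε : 0 < ε) {c n : ℕ}
    (hn : c ≤ n) :
    σ ^ (n - c) * (1 - σ) ^ 2 ≤ ε ↔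
      c + (Real.log ε - 2 * Real.log (1 - σ)) / Real.log σ ≤ n := by
  have h1' : 0 < 1 - σ := by linarith
  rw [← Real.log_le_log_iff (by positivity) hε, Real.log_mul (by positivity) (by positivity),
    Real.log_pow, Real.log_pow, ← le_sub_iff_add_le' (a := (c : ℝ)), div_le_iff_of_neg (Real.log_neg h0 h1),
    Nat.cast_sub hn, sub_mul]
  push_cast
  constructor <;> intro h <;> linarith

end GIMc

theorem lemma2p4 (c : ℕ) (hc : 1 ≤ c) (lam μ : ℝ) (hlam : 0 < lam) (hμ : 0 < μ)
    (A : Measure ℝ) [IsProbabilityMeasure A] (hA : A (Set.Iio 0) = 0)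
    (hAint : Integrable (fun t : ℝ => t) A) (hAmean : ∫ t, t ∂A = 1 / lam)
    (hstable : lam / (c * μ) < 1) :
    ∃ σ : ℝ, 0 < σ ∧ σ < 1 ∧ σ = GIMc.lst A (c * μ * (1 - σ)) ∧
      (∀ s : ℝ, |s| < 1 → s = GIMc.lst A (c * μ * (1 - s)) → s = σ) ∧
      ∃ π : ℕ → ℝ, GIMc.IsArrivalDistribution c μ A π ∧
        (∀ π' : ℕ → ℝ, GIMc.IsArrivalDistribution c μ A π' → π' = π) ∧
        (∀ n : ℕ, c ≤ n →
          π n = (1 - ∑ j ∈ Finset.range c, π j) / (σ ^ c * (1 - σ)⁻¹) * σ ^ n) ∧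
        ∀ ε : ℝ, 0 < ε →
          (∀ n : ℕ, c ≤ n →
            (n : ℝ) > c + (Real.log ε - 2 * Real.log (1 - σ)) / Real.log σ →
              |π (n + 1) - π n| < ε) ∧
          ∃ N : ℕ,
            IsLeast {n : ℕ | c ≤ n ∧
              (n : ℝ) ≥ c + (Real.log ε - 2 * Real.log (1 - σ)) / Real.log σ} N ∧
            ∀ n : ℕ, N ≤ n → |π (n + 1) - π n| < ε := by
  have hcμ : (0 : ℝ) < c * μ := mul_pos (by exact_mod_cast hc) hμ
  have hpos : 0 < ∫ t, t ∂A := hAmean ▸ one_div_pos.2 hlam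
  have hmean : 1 / (c * μ) < ∫ t, t ∂A :=
    hAmean ▸ one_div_lt_one_div_of_lt hlam ((div_lt_one hcμ).1 hstable)
  obtain ⟨σ, hσ0, hσ1, hσ⟩ := GIMc.exists_lst_fixedPoint hA hAint hcμ hmean
  obtain ⟨π, hπ, w, hw⟩ := GIMc.exists_isArrivalDistribution hA hc hμ.le hσ0.le hσ1 hσ
  have hσ1' : 0 < 1 - σ := sub_pos.2 hσ1
  have hgeom : ∀ n, c ≤ n → GIMc.geometricTail c σ n = (1 - σ) * σ ^ (n - c) := fun n hn => by
    rw [GIMc.geometricTail, if_neg (by omega)]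
  have hwsum : w = 1 - ∑ j ∈ Finset.range c, π j := by
    have h1 := (hasSum_nat_add_iff' c).2 hπ.hasSum_one
    have h2 := ((hasSum_nat_add_iff' c).2
      (GIMc.hasSum_geometricTail c hσ0.le hσ1)).mul_left w
    rw [Finset.sum_eq_zero fun i hi => by
      rw [GIMc.geometricTail, if_pos (Finset.mem_range.1 hi)], sub_zero, mul_one] at h2
    exact h2.unique (h1.congr_fun fun k => (hw _ (by omega)).symm)
  -- Strictness comes from `π 0 > 0` and `c ≥ 1`; it keeps the final bound strict even when `n`
  -- equals the threshold, as (d) needs.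
  have hw1 : w < 1 := by
    have := Finset.single_le_sum (f := π) (fun i _ => hπ.nonneg i)
      (Finset.mem_range.2 hc : 0 ∈ Finset.range c)
    have := hπ.zero_pos hA hpos hc hμ
    linarith
  have hw0 : 0 ≤ w := by
    rw [hwsum, sub_nonneg]
    exact sum_le_hasSum _ (fun i _ => hπ.nonneg i) hπ.hasSum_one
  have hclose : ∀ ε : ℝ, 0 < ε → ∀ n : ℕ, c ≤ n →
      c + (Real.log ε - 2 * Real.log (1 - σ)) / Real.log σ ≤ n → |π (n + 1) - π n| < ε := by
    intro ε hε n hn hle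
    rw [hw _ hn, hw _ (by omega), GIMc.geometricTail_add c σ hn, hgeom n hn,
      show w * ((1 - σ) * σ ^ (n - c) * σ ^ 1) - w * ((1 - σ) * σ ^ (n - c)) =
        -(w * (σ ^ (n - c) * (1 - σ) ^ 2)) by ring, abs_neg, abs_of_nonneg (by positivity)]
    exact (mul_lt_of_lt_one_left (by positivity) hw1).trans_le
      ((GIMc.pow_mul_one_sub_sq_le_iff hσ0 hσ1 hε hn).2 hle)
  refine ⟨σ, hσ0, hσ1, hσ, fun s hs hfix => GIMc.lst_fixedPoint_unique hA hpos hcμ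
    (abs_lt.1 hs).2 hfix hσ1 hσ, π, hπ, fun π' hπ' => hπ.unique hA hpos hc hμ hπ', ?_, ?_⟩
  · intro n hn
    rw [hw n hn, hgeom n hn, ← hwsum, pow_sub₀ _ hσ0.ne' hn]
    field_simp
  · intro ε hε
    refine ⟨fun n hn hgt => hclose ε hε n hn hgt.le, ?_⟩
    obtain ⟨b, hb⟩ := exists_nat_ge (c + (Real.log ε - 2 * Real.log (1 - σ)) / Real.log σ)
    have hne : {n : ℕ | c ≤ n ∧
        (n : ℝ) ≥ c + (Real.log ε - 2 * Real.log (1 - σ)) / Real.log σ}.Nonempty :=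
      ⟨max b c, le_max_right _ _, hb.trans (by exact_mod_cast le_max_left b c)⟩
    refine ⟨sInf _, ⟨Nat.sInf_mem hne, fun n hn => Nat.sInf_le hn⟩, fun n hn => ?_⟩
    have hmem := Nat.sInf_mem hne
    exact hclose ε hε n (hmem.1.trans hn) (le_trans hmem.2 (by exact_mod_cast hn))
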